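/- **Setting.** Let $f:\mathbb R^n\to\mathbb R$ be twice continuously differentiable and bounded below by $f_{\inf}\in\mathbb R$, let $g=\nabla f$, $H=\nabla^2 f$, and let $\|\cdot\|$ be the Euclidean norm or the induced operator norm. The algorithm I-TRACE has parameters $\xi_1>0$, $\xi_2\in(0,1)$, $\xi_3>0$, $\eta\in(0,1)$, $0<\underline\sigma<\overline\sigma$, $\gamma_C\in(0,1)$, $\gamma_E>1$, $\gamma_\lambda>1$ and input $x_0\in\mathbb R^n$, $\delta_0>0$, $\sigma_0\in[\underline\sigma,\overline\sigma]$. Outer iteration $k$ evaluates $g_k=g(x_k)$ and uses $f_k=f(x_k)$, $H_k=H(x_k)$. The Lanczos process is $q_{k,-1}=0$, $y_{k,0}=g_k$, $\gamma_{k,j}=\|y_{k,j}\|$, $q_{k,j}=y_{k,j}/\gamma_{k,j}$, $\theta_{k,j}=q_{k,j}^TH_kq_{k,j}$, $y_{k,j+1}=H_kq_{k,j}-\theta_{k,j}q_{k,j}-\gamma_{k,j}q_{k,j-1}$; put $Q_{k,j}=[q_{k,0}\cdots q_{k,j}]$ and let $T_{k,j}$ be the symmetric tridiagonal matrix with diagonal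 $\theta_{k,0},\dots,\theta_{k,j}$ and off-diagonal $\gamma_{k,1},\dots,\gamma_{k,j}$. Let $\mathcal S_{k,j}(\delta)$ be the problem $\min_t \gamma_{k,0}e_1^Tt+\frac12t^TT_{k,j}t$ s.t. $\|t\|\le\delta$; "solving" it means finding a global minimizer $t$ together with a Lagrange multiplier $\lambda$, i.e. $\lambda\ge0$, $\lambda(\delta-\|t\|)=0$, $\gamma_{k,0}e_1+(T_{k,j}+\lambda I)t=0$. Let $\mathcal R_{k,j}(\lambda)$ be the problem $\min_t \gamma_{k,0}e_1^Tt+\frac12t^T(T_{k,j}+\lambda I)t$. Let $\rho_k(s)=(f_k-f(x_k+s))/\|s\|^3$. A pair $(t,\lambda)$ is called *accurate* (for $k,j$) if, with $\mu=\gamma_{k,j+1}|e_{j+1}^Tt|$, either $\mu\le\xi_1\|t\|^2$, or both $\mu\le\xi_2\min\{1,\|t\|\}\gamma_{k,0}$ and $1\le\xi_3\min\{1,\|t\|\}\,\|T_{k,j}+\lambda I\|$. *Outer iteration $k$.* (TLTR) For $j=0,1,\dots$ solve $\mathcal S_{k,j}(\delta_k)$ until the solution $(t,\lambda)$ is accurate.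 Then loop: call FDS (below) for the current $j$, starting from $(t,\lambda)$, $\delta_k$, $\sigma_k$; it returns $(t,\lambda,\bar\delta,\bar\sigma)$. If the returned $(t,\lambda)$ is accurate, set $s_k=Q_{k,j}t$, $x_{k+1}=x_k+s_k$, $\delta_{k+1}=\max\{\bar\delta,\gamma_E\|s_k\|\}$, $\sigma_{k+1}=\bar\sigma$ and go to outer iteration $k+1$; otherwise increase $j$ by one, solve $\mathcal S_{k,j}(\delta_k)$ to get a new $(t,\lambda)$, and repeat the loop. *FDS.* Start with $(t_0,\lambda_0)=(t,\lambda)$, $\delta^{(0)}=\delta_k$, $\sigma^{(0)}=\sigma_k$. For $l=0,1,\dots$: * If $\rho_k(Q_{k,j}t_l)\ge\eta$ and $\lambda_l/\|t_l\|\le\sigma^{(l)}$, return $(t_l,\lambda_l,\delta^{(l)},\sigma^{(l)})$. * If $\rho_k(Q_{k,j}t_l)\ge\eta$ and $\lambda_l/\|t_l\|>\sigma^{(l)}$, set $\delta^{(l+1)}=\lambda_l/\sigma^{(l)}$, let $(t_{l+1},\lambda_{l+1})$ solve $\mathcal S_{k,j}(\delta^{(l+1)})$, and set $\sigma^{(l+1)}=\sigma^{(l)}$.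 * If $\rho_k(Q_{k,j}t_l)<\eta$ and $\lambda_l<\underline\sigma\|t_l\|$, let $\hat\lambda=\lambda_l+(\underline\sigma\gamma_{k,0})^{1/2}$ and let $\hat t$ solve $\mathcal R_{k,j}(\hat\lambda)$. If $\hat\lambda/\|\hat t\|\le\overline\sigma$, set $(t_{l+1},\lambda_{l+1})=(\hat t,\hat\lambda)$; otherwise choose any $\lambda_{l+1}\in(\lambda_l,\hat\lambda)$ such that the solution $t_{l+1}$ of $\mathcal R_{k,j}(\lambda_{l+1})$ satisfies $\underline\sigma<\lambda_{l+1}/\|t_{l+1}\|<\overline\sigma$. In both cases $\delta^{(l+1)}=\|t_{l+1}\|$ and $\sigma^{(l+1)}=\max\{\sigma^{(l)},\lambda_{l+1}/\|t_{l+1}\|\}$. * If $\rho_k(Q_{k,j}t_l)<\eta$ and $\lambda_l\ge\underline\sigma\|t_l\|$, let $\hat\lambda=\gamma_\lambda\lambda_l$ and let $\hat t$ solve $\mathcal R_{k,j}(\hat\lambda)$. If $\|\hat t\|\ge\gamma_C\delta^{(l)}$, set $(t_{l+1},\lambda_{l+1},\delta^{(l+1)})=(\hat t,\hat\lambda,\|\hat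 t\|)$; otherwise set $\delta^{(l+1)}=\gamma_C\delta^{(l)}$ and let $(t_{l+1},\lambda_{l+1})$ solve $\mathcal S_{k,j}(\delta^{(l+1)})$. In both cases $\sigma^{(l+1)}=\max\{\sigma^{(l)},\lambda_{l+1}/\|t_{l+1}\|\}$. **Theorem.** Consider any (finite or infinite) execution of I-TRACE. Suppose that $g_k\ne0$ for all generated $k$, and that $g$ and $H$ are Lipschitz continuous with constants $g_{\rm Lip}>0$ and $H_{\rm Lip}>0$ on an open convex set containing every generated iterate $x_k$ and every trial point $x_k+Q_{k,j}t_l$ generated in FDS. Put $\sigma_{\max}=\max\{\sigma_0,\overline\sigma,(\gamma_\lambda/\gamma_C)(H_{\rm Lip}+2\eta)\}$. Then for every $\epsilon\in(0,1)$ the set $\mathcal K(\epsilon)$ of all generated outer iterations $k$ with $\|g_k\|>\epsilon$ has at most $$K(\epsilon)=1+\left\lfloor\frac{(f_0-f_{\inf})\left(\tfrac12H_{\rm Lip}+\sigma_{\max}+\max\{\xi_1,\xi_2g_{\rm Lip}\}\right)^{3/2}}{\eta(1-\xi_2)^{3/2}}\,\epsilon^{-3/2}\right\rfloor$$ elements.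 Hence the number of outer iterations at iterates with $\|g_k\|>\epsilon$ and the number of gradient evaluations performed at such iterates are each at most $c\,\epsilon^{-3/2}$ for all $\epsilon\in(0,1)$, where the constant $c>0$ depends only on the algorithm parameters, $\sigma_0$, $g_{\rm Lip}$, $H_{\rm Lip}$ and an upper bound on $f_0-f_{\inf}$. -/

import Mathlib

open scoped Gradient

noncomputable section

namespace ITrace

/-- Real `n`-dimensional space with the Euclidean norm. -/
abbrev Vec (n : ℕ) : Type := EuclideanSpace ℝ (Fin n)

/-- The Hessian of `f` at `x`, as a linear operator: the derivative of the gradient map. -/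
def hess {n : ℕ} (f : Vec n → ℝ) (x : Vec n) : Vec n →L[ℝ] Vec n := fderiv ℝ (∇ f) x

/-- The user-prescribed parameters of the algorithm. -/
structure Params where
  ξ₁ : ℝ
  ξ₂ : ℝ
  ξ₃ : ℝ
  η : ℝ
  sigLo : ℝ
  sigHi : ℝ
  γC : ℝ
  γE : ℝ
  γL : ℝ
  ξ₁_pos : 0 < ξ₁
  ξ₂_mem : ξ₂ ∈ Set.Ioo (0 : ℝ) 1
  ξ₃_pos : 0 < ξ₃
  η_mem : η ∈ Set.Ioo (0 : ℝ) 1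
  sigLo_pos : 0 < sigLo
  sigLo_lt : sigLo < sigHi
  γC_mem : γC ∈ Set.Ioo (0 : ℝ) 1
  one_lt_γE : 1 < γE
  one_lt_γL : 1 < γL

/-- The derivative data available to the subroutines in one outer iteration:
the gradient `g` and the Hessian `H` at the current iterate. -/
structure Local (n : ℕ) where
  g : Vec n
  H : Vec n →L[ℝ] Vec n

namespace Local

variable {n : ℕ} (M : Local n)

/-- The Lanczos recursion for `(H, g)`: the value at `j` is the pair `(q_{j-1}, y_j)`, with
`q_{-1} = 0`, `y_0 = g`, `q_j = y_j / ‖y_j‖`, and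
`y_{j+1} = H q_j - (q_jᵀ H q_j) q_j - ‖y_j‖ q_{j-1}`. -/
def lanczos : ℕ → Vec n × Vec n
  | 0 => (0, M.g)
  | j + 1 =>
    let p := (lanczos j).1
    let y := (lanczos j).2
    let q := ‖y‖⁻¹ • y
    (q, M.H q - (inner ℝ q (M.H q)) • q - ‖y‖ • p)

/-- `γ_j = ‖y_j‖`; in particular `γ_0 = ‖g‖`. -/
def gam (j : ℕ) : ℝ := ‖(M.lanczos j).2‖

/-- The Lanczos vector `q_j = y_j / γ_j`. -/
def q (j : ℕ) : Vec n := (M.gam j)⁻¹ • (M.lanczos j).2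

/-- `θ_j = q_jᵀ H q_j`. -/
def theta (j : ℕ) : ℝ := inner ℝ (M.q j) (M.H (M.q j))

/-- The `(j+1) × (j+1)` symmetric tridiagonal matrix `T_j` with diagonal `θ_0, …, θ_j` and
off-diagonal entries `γ_1, …, γ_j`. -/
def T (j : ℕ) : Matrix (Fin (j + 1)) (Fin (j + 1)) ℝ :=
  Matrix.of fun a b =>
    if (a : ℕ) = b then M.theta a
    else if (a : ℕ) = b + 1 then M.gam a
    else if (b : ℕ) = a + 1 then M.gam b
    else 0

/-- `T_j + λ I` as an operator on Euclidean space; its norm is the induced 2-norm. -/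
def Treg (j : ℕ) (lam : ℝ) : Vec (j + 1) →L[ℝ] Vec (j + 1) :=
  Matrix.toEuclideanCLM (𝕜 := ℝ) (n := Fin (j + 1)) (M.T j + lam • 1)

/-- The full-space vector `Q_j t = ∑ i, t_i q_i`. -/
def Q (j : ℕ) (t : Vec (j + 1)) : Vec n := ∑ i : Fin (j + 1), t i • M.q i

/-- `γ_0 e_1`. -/
def rhs (j : ℕ) : Vec (j + 1) := EuclideanSpace.single 0 (M.gam 0)

/-- The regularized reduced objective `γ_0 e_1ᵀ t + ½ tᵀ (T_j + λ I) t`. -/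
def obj (j : ℕ) (lam : ℝ) (t : Vec (j + 1)) : ℝ :=
  inner ℝ (M.rhs j) t + 1 / 2 * inner ℝ t (M.Treg j lam t)

/-- `(t, λ)` is a primal-dual solution of the trust-region subproblem
`min γ_0 e_1ᵀ t + ½ tᵀ T_j t` subject to `‖t‖ ≤ δ`: the vector `t` is a global minimizer and
`λ` is a Lagrange multiplier for it. -/
structure SolvesTR (j : ℕ) (δ : ℝ) (t : Vec (j + 1)) (lam : ℝ) : Prop where
  feasible : ‖t‖ ≤ δ
  minimal : ∀ t' : Vec (j + 1), ‖t'‖ ≤ δ → M.obj j 0 t ≤ M.obj j 0 t'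
  stationary : M.rhs j + M.Treg j lam t = 0
  nonneg : 0 ≤ lam
  complementary : lam * (δ - ‖t‖) = 0

/-- `t` solves the regularized subproblem `min γ_0 e_1ᵀ t + ½ tᵀ (T_j + λ I) t`. -/
def SolvesReg (j : ℕ) (lam : ℝ) (t : Vec (j + 1)) : Prop :=
  ∀ t' : Vec (j + 1), M.obj j lam t ≤ M.obj j lam t'

/-- `μ_j = γ_{j+1} |e_{j+1}ᵀ t|`. -/
def mu (j : ℕ) (t : Vec (j + 1)) : ℝ := M.gam (j + 1) * |t (Fin.last j)|

/-- The accuracy test on the residual, evaluated in the reduced space. -/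
def Accurate (P : Params) (j : ℕ) (t : Vec (j + 1)) (lam : ℝ) : Prop :=
  M.mu j t ≤ P.ξ₁ * ‖t‖ ^ 2 ∨
    (M.mu j t ≤ P.ξ₂ * min 1 ‖t‖ * M.gam 0 ∧ 1 ≤ P.ξ₃ * min 1 ‖t‖ * ‖M.Treg j lam‖)

end Local

/-- The ratio `ρ(s) = (f(x) - f(x + s)) / ‖s‖³` at the iterate `x`. -/
def rho {n : ℕ} (f : Vec n → ℝ) (x s : Vec n) : ℝ := (f x - f (x + s)) / ‖s‖ ^ 3

/-- The control location inside an outer iteration, with the local variables live there. -/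
inductive Phase (n : ℕ) : Type
  /-- The outer iteration is about to start. -/
  | start : Phase n
  /-- Truncated Lanczos trust-region routine (TLTR), about to treat Krylov index `j`. -/
  | tltr (M : Local n) (j : ℕ) : Phase n
  /-- Routine "find decrease step" (FDS) for Krylov index `j`, at the top of its loop, with
  `(t, lam, δl, σl)` the current `(t_{k,j,l}, λ_{k,j,l}, δ_{k,j,l}, σ_{k,j,l})`. -/
  | fds (M : Local n) (j : ℕ) (t : Vec (j + 1)) (lam δl σl : ℝ) : Phase n
  /-- FDS has returned `(t, lam)` and the values `(δbar, σbar)`. -/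
  | check (M : Local n) (j : ℕ) (t : Vec (j + 1)) (lam δbar σbar : ℝ) : Phase n

/-- A configuration of the algorithm: outer iteration counter `k`, iterate `x = x_k`, radius
`δ = δ_k`, bound `σ = σ_k`, the list of all points at which the gradient of `f` has been
evaluated so far (with repetitions), and the control location. -/
structure Config (n : ℕ) where
  k : ℕ
  x : Vec n
  δ : ℝ
  σ : ℝ
  gradLog : List (Vec n)
  phase : Phase n

/-- One step of I-TRACE. The gradient of `f` is evaluated only in the step `begin`, which stores
its value and records the evaluation in the log. -/
inductive Step (P : Params) {n : ℕ} (f : Vec n → ℝ) : Config n → Config n → Prop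
  /-- Evaluate the derivatives at the iterate and call TLTR. -/
  | begin (c : Config n) (hc : c.phase = .start) :
      Step P f c { c with
        gradLog := c.x :: c.gradLog
        phase := .tltr ⟨∇ f c.x, hess f c.x⟩ 0 }
  /-- TLTR: the subproblem solution is not accurate enough; enlarge the Krylov space. -/
  | tltr_continue (c : Config n) (M : Local n) (j : ℕ) (t : Vec (j + 1)) (lam : ℝ)
      (hc : c.phase = .tltr M j) (hs : M.SolvesTR j c.δ t lam)
      (ha : ¬ M.Accurate P j t lam) :
      Step P f c { c with phase := .tltr M (j + 1) }
  /-- TLTR: the subproblem solution is accurate enough; return it and call FDS. -/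
  | tltr_return (c : Config n) (M : Local n) (j : ℕ) (t : Vec (j + 1)) (lam : ℝ)
      (hc : c.phase = .tltr M j) (hs : M.SolvesTR j c.δ t lam)
      (ha : M.Accurate P j t lam) :
      Step P f c { c with phase := .fds M j t lam c.δ c.σ }
  /-- FDS: decrease step found. -/
  | fds_return (c : Config n) (M : Local n) (j : ℕ) (t : Vec (j + 1)) (lam δl σl : ℝ)
      (hc : c.phase = .fds M j t lam δl σl)
      (hρ : P.η ≤ rho f c.x (M.Q j t)) (hr : lam / ‖t‖ ≤ σl) :
      Step P f c { c with phase := .check M j t lam δl σl }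
  /-- FDS: expand the trust region. -/
  | fds_expand (c : Config n) (M : Local n) (j : ℕ) (t : Vec (j + 1)) (lam δl σl : ℝ)
      (t' : Vec (j + 1)) (lam' : ℝ)
      (hc : c.phase = .fds M j t lam δl σl)
      (hρ : P.η ≤ rho f c.x (M.Q j t)) (hr : σl < lam / ‖t‖)
      (hs : M.SolvesTR j (lam / σl) t' lam') :
      Step P f c { c with phase := .fds M j t' lam' (lam / σl) σl }
  /-- FDS: contract; the multiplier is small and the increased one gives an acceptable ratio. -/
  | fds_contract_small (c : Config n) (M : Local n) (j : ℕ) (t : Vec (j + 1)) (lam δl σl : ℝ)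
      (t' : Vec (j + 1)) (lam' : ℝ)
      (hc : c.phase = .fds M j t lam δl σl)
      (hρ : rho f c.x (M.Q j t) < P.η) (hr : lam < P.sigLo * ‖t‖)
      (hlam : lam' = lam + Real.sqrt (P.sigLo * M.gam 0))
      (hs : M.SolvesReg j lam' t') (hr' : lam' / ‖t'‖ ≤ P.sigHi) :
      Step P f c { c with phase := .fds M j t' lam' ‖t'‖ (max σl (lam' / ‖t'‖)) }
  /-- FDS: contract; the multiplier is small and the increased one gives too large a ratio, so
  an intermediate value is taken. -/
  | fds_contract_between (c : Config n) (M : Local n) (j : ℕ) (t : Vec (j + 1))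
      (lam δl σl : ℝ) (that : Vec (j + 1)) (lamhat : ℝ) (t' : Vec (j + 1)) (lam' : ℝ)
      (hc : c.phase = .fds M j t lam δl σl)
      (hρ : rho f c.x (M.Q j t) < P.η) (hr : lam < P.sigLo * ‖t‖)
      (hlam : lamhat = lam + Real.sqrt (P.sigLo * M.gam 0))
      (hhat : M.SolvesReg j lamhat that) (hr' : P.sigHi < lamhat / ‖that‖)
      (hmem : lam' ∈ Set.Ioo lam lamhat) (hs : M.SolvesReg j lam' t')
      (hbetween : lam' / ‖t'‖ ∈ Set.Ioo P.sigLo P.sigHi) :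
      Step P f c { c with phase := .fds M j t' lam' ‖t'‖ (max σl (lam' / ‖t'‖)) }
  /-- FDS: contract; the multiplier is not small and scaling it up does not shrink the step
  too much. -/
  | fds_contract_scale (c : Config n) (M : Local n) (j : ℕ) (t : Vec (j + 1)) (lam δl σl : ℝ)
      (t' : Vec (j + 1)) (lam' : ℝ)
      (hc : c.phase = .fds M j t lam δl σl)
      (hρ : rho f c.x (M.Q j t) < P.η) (hr : P.sigLo * ‖t‖ ≤ lam)
      (hlam : lam' = P.γL * lam)
      (hs : M.SolvesReg j lam' t') (hn : P.γC * δl ≤ ‖t'‖) :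
      Step P f c { c with phase := .fds M j t' lam' ‖t'‖ (max σl (lam' / ‖t'‖)) }
  /-- FDS: contract; the multiplier is not small and scaling it up shrinks the step too much, so
  the radius is contracted explicitly. -/
  | fds_contract_radius (c : Config n) (M : Local n) (j : ℕ) (t : Vec (j + 1)) (lam δl σl : ℝ)
      (that : Vec (j + 1)) (t' : Vec (j + 1)) (lam' : ℝ)
      (hc : c.phase = .fds M j t lam δl σl)
      (hρ : rho f c.x (M.Q j t) < P.η) (hr : P.sigLo * ‖t‖ ≤ lam)
      (hhat : M.SolvesReg j (P.γL * lam) that) (hn : ‖that‖ < P.γC * δl)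
      (hs : M.SolvesTR j (P.γC * δl) t' lam') :
      Step P f c { c with phase := .fds M j t' lam' (P.γC * δl) (max σl (lam' / ‖t'‖)) }
  /-- Main loop: the step returned by FDS is accurate enough; accept it. -/
  | accept (c : Config n) (M : Local n) (j : ℕ) (t : Vec (j + 1)) (lam δbar σbar : ℝ)
      (hc : c.phase = .check M j t lam δbar σbar) (ha : M.Accurate P j t lam) :
      Step P f c { c with
        k := c.k + 1
        x := c.x + M.Q j t
        δ := max δbar (P.γE * ‖M.Q j t‖)
        σ := σbar
        phase := .start }
  /-- Main loop: the step returned by FDS is not accurate enough; enlarge the Krylov space,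
  solve the subproblem with the radius `δ_k` and call FDS again. -/
  | enlarge (c : Config n) (M : Local n) (j : ℕ) (t : Vec (j + 1)) (lam δbar σbar : ℝ)
      (t' : Vec (j + 1 + 1)) (lam' : ℝ)
      (hc : c.phase = .check M j t lam δbar σbar) (ha : ¬ M.Accurate P j t lam)
      (hs : M.SolvesTR (j + 1) c.δ t' lam') :
      Step P f c { c with phase := .fds M (j + 1) t' lam' c.δ c.σ }

/-- `run 0, run 1, …` (up to index `N`, where `N = ⊤` means forever) is an execution of I-TRACE
on `f` with input `x₀, δ₀, σ₀`. -/
def IsRun (P : Params) {n : ℕ} (f : Vec n → ℝ) (x₀ : Vec n) (δ₀ σ₀ : ℝ) (N : ℕ∞)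
    (run : ℕ → Config n) : Prop :=
  run 0 = ⟨0, x₀, δ₀, σ₀, [], .start⟩ ∧
    ∀ i : ℕ, ((i + 1 : ℕ) : ℕ∞) ≤ N → Step P f (run i) (run (i + 1))

/-- The iterate `x_k` and, inside FDS, the trial point `x_k + Q_{k,j} t_{k,j,l}`. -/
def Config.points {n : ℕ} (c : Config n) : Set (Vec n) :=
  match c.phase with
  | .fds M j t _ _ _ => {c.x, c.x + M.Q j t}
  | _ => {c.x}

/-- The set `𝒦(ε)` of the outer iterations `k` that are reached with `‖∇f(x_k)‖ > ε`. -/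
def nonstationary {n : ℕ} (f : Vec n → ℝ) (N : ℕ∞) (run : ℕ → Config n) (ε : ℝ) : Set ℕ :=
  {k | ∃ i : ℕ, (i : ℕ∞) ≤ N ∧ (run i).k = k ∧ ε < ‖∇ f (run i).x‖}

/-- The number of gradient evaluations performed so far at points that are not
`ε`-stationary. -/
def Config.gradEvals {n : ℕ} (f : Vec n → ℝ) (ε : ℝ) (c : Config n) : ℕ :=
  c.gradLog.countP fun y => ε < ‖∇ f y‖

/-- `σ_max = max {σ_0, σ̄, (γ_λ / γ_C) (H_Lip + 2 η)}`. -/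
def sigMax (P : Params) (σ₀ HLip : ℝ) : ℝ :=
  max σ₀ (max P.sigHi (P.γL / P.γC * (HLip + 2 * P.η)))

/-- The iteration bound `K(ε)`, where `gap = f(x_0) - f_inf`. -/
def K (P : Params) (σ₀ gLip HLip gap ε : ℝ) : ℕ :=
  1 + ⌊gap * (1 / 2 * HLip + sigMax P σ₀ HLip + max P.ξ₁ (P.ξ₂ * gLip)) ^ (3 / 2 : ℝ) /
      (P.η * (1 - P.ξ₂) ^ (3 / 2 : ℝ)) * ε ^ (-(3 / 2) : ℝ)⌋₊

end ITrace

end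

/-! Every accepted step that ends at a point with `‖∇ f‖ > ε` lowers `f` by at least the fixed
amount `decrease`, of order `ε ^ (3/2)`, and no accepted step raises `f`. As `f` is bounded below,
there are at most `gap / decrease` such steps; the extra 1 pays for `x₀`, which is not the end of
any step. The gradient is evaluated once per outer iteration, so the same bound counts evaluations.

The decrease has two sources. Acceptance requires `ρ ≥ η`, that is, a decrease of at least `η ‖s‖³`.
Conversely `‖s‖²` dominates the new gradient (`Regular.gradient_le`): `∇ f (x + s)` is the Taylor
error, of size `½ HLip ‖s‖²`, plus the residual of the regularized Newton equation, controlled by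
the accuracy test, minus `λ s`, of size at most `σ ‖s‖²`. `Regular.decrease_le` combines the two.

What remains is the uniform bound `σ ≤ sigMax` (`Config.OK.step`). The bound `σ` grows only after a
rejection, and a rejected pair satisfies `λ < (HLip + 2η) ‖t‖` (`Regular.ratio_lt_of_rho_lt`). A
contraction either keeps the new ratio below `sigHi` by construction, or enlarges `λ` by at most
`γL` while shrinking the step by at most `γC` (`scaled_ratio_le`, `SolvesReg.norm_le`).

Reduced and full-space quantities agree because `Q_j` is an isometry until the Lanczos process
breaks down (`orthonormal_lanczos`). Breakdown is never passed: a vanishing `γ_{j+1}` makes the pair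
accurate (`gam_succ_ne_zero_of_not_accurate`). -/

noncomputable section

namespace ITrace

/-! ### Minimizers of regularized quadratic functions -/

section Quadratic

variable {E : Type*} [NormedAddCommGroup E] [InnerProductSpace ℝ E]

/-- A global minimizer of a quadratic function is a stationary point. -/
lemma stationary_of_isMin_quadratic (A : E →L[ℝ] E) (hA : ∀ u v, inner ℝ (A u) v = inner ℝ u (A v))
    (b t : E)
    (h : ∀ t', inner ℝ b t + 1 / 2 * inner ℝ t (A t) ≤ inner ℝ b t' + 1 / 2 * inner ℝ t' (A t')) :
    b + A t = 0 := by
  set r := b + A t with hr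
  by_contra hne
  have ha : 0 < ‖r‖ ^ 2 := by positivity
  set β : ℝ := inner ℝ r (A r) with hβ
  -- Minimality tested along the steepest descent direction `-r`.
  have hexp : ∀ τ : ℝ, 0 ≤ -(τ * ‖r‖ ^ 2) + τ ^ 2 / 2 * β := by
    intro τ
    have h1 := h (t - τ • r)
    have h2 : inner ℝ r r = inner ℝ b r + inner ℝ t (A r) := by
      conv_lhs => rw [hr, ← hr]
      rw [hr, inner_add_left, ← hr, hA]
    have h3 : inner ℝ r (A t) = inner ℝ t (A r) := by rw [real_inner_comm, hA]
    rw [real_inner_self_eq_norm_sq] at h2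
    simp only [map_sub, map_smul, inner_sub_right, inner_sub_left, inner_smul_left,
      inner_smul_right, RCLike.conj_to_real, h3] at h1
    rw [h2]
    nlinarith [h1]
  have hden : 0 < |β| + 1 := by positivity
  -- At this step length the quadratic term is at most half the linear one; the `+ 1` keeps the
  -- denominator positive.
  have := hexp (‖r‖ ^ 2 / (|β| + 1))
  have h4 : (‖r‖ ^ 2 / (|β| + 1)) * β ≤ ‖r‖ ^ 2 := by
    rw [div_mul_eq_mul_div, div_le_iff₀ hden]
    nlinarith [le_abs_self β]
  have h5 : 0 < ‖r‖ ^ 2 / (|β| + 1) := by positivity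
  nlinarith

/-- The norm of the minimizer of a regularized quadratic is antitone in the regularization
parameter. -/
lemma norm_le_of_regularized (A : E →L[ℝ] E) (hA : ∀ u v, inner ℝ (A u) v = inner ℝ u (A v))
    (b t t' : E) {α β : ℝ} (hαβ : α < β)
    (h : ∀ u, inner ℝ b t + 1 / 2 * inner ℝ t (A t + α • t)
      ≤ inner ℝ b u + 1 / 2 * inner ℝ u (A u + α • u))
    (ht' : b + (A t' + β • t') = 0) : ‖t'‖ ≤ ‖t‖ := by
  have hst : b + (A t + α • t) = 0 := by
    have := stationary_of_isMin_quadratic (A + α • ContinuousLinearMap.id ℝ E)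
      (fun u v => by simp [inner_add_left, inner_add_right, hA, inner_smul_left, inner_smul_right])
      b t (by simpa using h)
    simpa using this
  have h1 := h t'
  have hb : b = -(A t + α • t) := eq_neg_of_add_eq_zero_left hst
  have hb' : b = -(A t' + β • t') := eq_neg_of_add_eq_zero_left ht'
  -- Pairing each stationarity equation with both `t` and `t'` eliminates `A` from the comparison
  -- `h1` and leaves `e8`. Definiteness of `A + β I` is not needed.
  have e1 : inner ℝ b t' = -(inner ℝ t (A t') + α * inner ℝ t t') := by
    rw [hb, inner_neg_left, inner_add_left, hA, inner_smul_left]; simp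
  have e2 : inner ℝ b t = -(inner ℝ t (A t) + α * inner ℝ t t) := by
    rw [hb, inner_neg_left, inner_add_left, hA, inner_smul_left]; simp
  have e3 : inner ℝ b t = -(inner ℝ t (A t') + β * inner ℝ t t') := by
    rw [hb', inner_neg_left, real_inner_comm, inner_add_right, inner_smul_right]
  have e4 : inner ℝ b t' = -(inner ℝ t' (A t') + β * inner ℝ t' t') := by
    rw [hb', inner_neg_left, real_inner_comm, inner_add_right, inner_smul_right]
  simp only [inner_add_right, inner_smul_right] at h1
  have e5 : inner ℝ t t = ‖t‖ ^ 2 := real_inner_self_eq_norm_sq t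
  have e6 : inner ℝ t' t' = ‖t'‖ ^ 2 := real_inner_self_eq_norm_sq t'
  have e7 : inner ℝ t t' ≤ ‖t‖ * ‖t'‖ := real_inner_le_norm t t'
  have e8 : (β - α) * (‖t'‖ ^ 2 - inner ℝ t t') ≤ 0 := by nlinarith
  have e9 : ‖t'‖ ^ 2 ≤ inner ℝ t t' := by
    by_contra hc
    push Not at hc
    nlinarith [mul_pos (sub_pos.2 hαβ) (sub_pos.2 hc)]
  by_contra hc
  push Not at hc
  nlinarith [norm_nonneg t, norm_nonneg t']

end Quadratic

/-! ### The Lanczos process and the tridiagonal reduction -/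

namespace Local

variable {n : ℕ} (M : Local n)

/-- The previous Lanczos vector `q_{j-1}`, with `q_{-1} = 0`. -/
def qPrev (j : ℕ) : Vec n := (M.lanczos j).1

lemma qPrev_zero : M.qPrev 0 = 0 := rfl

lemma qPrev_succ (j : ℕ) : M.qPrev (j + 1) = M.q j := rfl

lemma lanczos_succ_snd (j : ℕ) : (M.lanczos (j + 1)).2 =
    M.H (M.q j) - M.theta j • M.q j - M.gam j • M.qPrev j := rfl

lemma gam_smul_q (j : ℕ) : M.gam j • M.q j = (M.lanczos j).2 := by
  by_cases h : M.gam j = 0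
  · rw [h, zero_smul]
    exact (norm_eq_zero.1 h).symm
  · rw [q, smul_smul, mul_inv_cancel₀ h, one_smul]

lemma gam_nonneg (j : ℕ) : 0 ≤ M.gam j := norm_nonneg _

/-- The three-term recurrence. -/
lemma H_q (j : ℕ) : M.H (M.q j) =
    M.gam (j + 1) • M.q (j + 1) + M.theta j • M.q j + M.gam j • M.qPrev j := by
  rw [gam_smul_q, lanczos_succ_snd]; abel

lemma norm_q {j : ℕ} (h : M.gam j ≠ 0) : ‖M.q j‖ = 1 := by
  rw [q, norm_smul, norm_inv, Real.norm_of_nonneg (M.gam_nonneg j)]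
  exact inv_mul_cancel₀ h

/-- The Lanczos vectors are orthonormal up to the first breakdown, and the next residual is
orthogonal to them. -/
lemma orthonormal_lanczos (hH : ∀ u v, inner ℝ (M.H u) v = inner ℝ u (M.H v)) (j : ℕ)
    (hj : ∀ i ≤ j, M.gam i ≠ 0) :
    (∀ a ≤ j, ∀ b ≤ j, inner ℝ (M.q a) (M.q b) = if a = b then (1 : ℝ) else 0) ∧
      ∀ a ≤ j, inner ℝ (M.q a) (M.lanczos (j + 1)).2 = (0 : ℝ) := by
  -- For `a < j`, symmetry moves `H` onto `q_a`, and by the three-term recurrence only its `q_{a+1}`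
  -- component can meet `q_j`. This is nonzero only for `a = j - 1`, where the term `γ_j q_{j-1}`
  -- cancels it; for `a = j` the term `θ_j q_j` does.
  have key : ∀ j : ℕ,
      (∀ a ≤ j, ∀ b ≤ j, inner ℝ (M.q a) (M.q b) = if a = b then (1 : ℝ) else 0) →
      ∀ a ≤ j, inner ℝ (M.q a) (M.lanczos (j + 1)).2 = (0 : ℝ) := by
    intro j ho a ha
    rw [lanczos_succ_snd, inner_sub_right, inner_sub_right, inner_smul_right, inner_smul_right,
      ho a ha j le_rfl]
    rcases ha.lt_or_eq with hlt | rfl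
    · obtain ⟨m, rfl⟩ : ∃ m, j = m + 1 := ⟨j - 1, by omega⟩
      rw [qPrev_succ, ho a ha m (by omega), ← hH, H_q, inner_add_left, inner_add_left,
        inner_smul_left, inner_smul_left, inner_smul_left, ho (a + 1) (by omega) _ le_rfl,
        ho a ha _ le_rfl]
      have hp : inner ℝ (M.qPrev a) (M.q (m + 1)) = (0 : ℝ) := by
        cases a with
        | zero => simp [qPrev_zero]
        | succ a =>
          rw [qPrev_succ, ho a (by omega) _ le_rfl, if_neg (by omega)]
      rw [hp, if_neg (by omega : a ≠ m + 1)]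
      by_cases h : a = m
      · subst h; simp
      · simp [h]
    · have hp : inner ℝ (M.q a) (M.qPrev a) = (0 : ℝ) := by
        cases a with
        | zero => simp [qPrev_zero]
        | succ a => rw [qPrev_succ, ho _ le_rfl a (by omega), if_neg (by omega)]
      rw [hp, if_pos rfl, theta]; ring
  have main : ∀ a ≤ j, ∀ b ≤ j, inner ℝ (M.q a) (M.q b) = if a = b then (1 : ℝ) else 0 := by
    induction j with
    | zero =>
      intro a ha b hb
      obtain rfl : a = 0 := by omega
      obtain rfl : b = 0 := by omega
      rw [real_inner_self_eq_norm_sq, M.norm_q (hj 0 le_rfl)]; simp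
    | succ m ih =>
      have ho := ih fun i hi => hj i (by omega)
      have hk := key m ho
      have hq : ∀ a ≤ m, inner ℝ (M.q a) (M.q (m + 1)) = (0 : ℝ) := by
        intro a ha
        rw [q.eq_1 M (m + 1), inner_smul_right, hk a ha, mul_zero]
      intro a ha b hb
      rcases ha.lt_or_eq with hlt | rfl
      · rcases hb.lt_or_eq with hlt' | rfl
        · exact ho a (by omega) b (by omega)
        · rw [hq a (by omega), if_neg (by omega)]
      · rcases hb.lt_or_eq with hlt' | rfl
        · rw [real_inner_comm, hq b (by omega), if_neg (by omega)]
        · rw [real_inner_self_eq_norm_sq, M.norm_q (hj _ le_rfl)]; simp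
  exact ⟨main, key j main⟩

lemma T_comm (j : ℕ) (a b : Fin (j + 1)) : M.T j a b = M.T j b a := by
  simp only [T, Matrix.of_apply]
  split_ifs <;> first | rfl | omega | simp_all

lemma Treg_apply (j : ℕ) (lam : ℝ) (t : Vec (j + 1)) :
    M.Treg j lam t = M.Treg j 0 t + lam • t := by
  simp [Treg, map_add, map_smul]

lemma Treg_zero_apply (j : ℕ) (t : Vec (j + 1)) (a : Fin (j + 1)) :
    M.Treg j 0 t a = ∑ b, M.T j a b * t b := by
  simp [Treg, Matrix.mulVec, dotProduct]

lemma inner_Treg_zero (j : ℕ) (u v : Vec (j + 1)) :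
    inner ℝ (M.Treg j 0 u) v = inner ℝ u (M.Treg j 0 v) := by
  simp only [PiLp.inner_apply, Treg_zero_apply, RCLike.inner_apply, conj_trivial,
    Finset.mul_sum, Finset.sum_mul]
  rw [Finset.sum_comm]
  refine Finset.sum_congr rfl fun a _ => Finset.sum_congr rfl fun b _ => ?_
  rw [M.T_comm j b a]; ring

/-- Columns of `T_j` encode the action of `H` on the Lanczos vectors, up to the residual. -/
lemma sum_T_smul_q (j : ℕ) (b : Fin (j + 1)) :
    ∑ a, M.T j a b • M.q a =
      M.H (M.q b) - if b = Fin.last j then (M.lanczos (j + 1)).2 else 0 := by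
  -- The three bands of column `b` exclude each other, so the nested conditional splits into a sum.
  have h1 : ∀ a : ℕ, (if a = (b : ℕ) then M.theta a else if a = b + 1 then M.gam a
      else if (b : ℕ) = a + 1 then M.gam b else 0) • M.q a =
      (if a = (b : ℕ) then M.theta b • M.q b else 0)
      + (if a = b + 1 then M.gam (b + 1) • M.q (b + 1) else 0)
      + (if (b : ℕ) = a + 1 then M.gam b • M.qPrev b else 0) := by
    intro a
    by_cases e1 : a = (b : ℕ)
    · rw [if_pos e1, if_pos e1, if_neg (by omega), if_neg (by omega), e1]; simp
    · rw [if_neg e1, if_neg e1]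
      by_cases e2 : a = b + 1
      · rw [if_pos e2, if_pos e2, if_neg (by omega), e2]; simp
      · rw [if_neg e2, if_neg e2]
        by_cases e3 : (b : ℕ) = a + 1
        · rw [if_pos e3, if_pos e3, e3, qPrev_succ]; simp
        · simp [e3]
  have h2 : ∑ a, M.T j a b • M.q a = ∑ a ∈ Finset.range (j + 1),
      (if a = (b : ℕ) then M.theta a else if a = b + 1 then M.gam a
      else if (b : ℕ) = a + 1 then M.gam b else 0) • M.q a := by
    rw [Finset.sum_range]; rfl
  rw [h2, Finset.sum_congr rfl fun a _ => h1 a, Finset.sum_add_distrib, Finset.sum_add_distrib,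
    Finset.sum_ite_eq' (Finset.range (j + 1)) (b : ℕ), Finset.sum_ite_eq', H_q, gam_smul_q]
  -- For `b = 0` no index contributes, in agreement with `q_{-1} = 0`.
  have h3 : ∑ a ∈ Finset.range (j + 1), (if (b : ℕ) = a + 1 then M.gam b • M.qPrev b else 0)
      = M.gam b • M.qPrev b := by
    rcases Nat.eq_zero_or_pos (b : ℕ) with h0 | h0
    · rw [h0, qPrev_zero]; simp
    · rw [Finset.sum_eq_single ((b : ℕ) - 1)]
      · rw [if_pos (by omega)]
      · intro a _ ha; rw [if_neg (by omega)]
      · intro ha; simp at ha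
  have hb := b.2
  rw [h3, if_pos (by simp; omega)]
  -- In the last column the subdiagonal entry falls outside the matrix; the missing term `γ_{j+1}
  -- q_{j+1}` is the residual `y_{j+1}`.
  by_cases hlast : b = Fin.last j
  · rw [if_neg (by simp [hlast]), if_pos hlast, hlast]
    simp only [Fin.val_last]; abel
  · have : (b : ℕ) ≠ j := fun h => hlast (Fin.ext h)
    rw [if_pos (by simp; omega), if_neg hlast]; abel

/-- `H Q_j t = Q_j T_j t + t_j y_{j+1}`. -/
lemma H_Q (j : ℕ) (t : Vec (j + 1)) :
    M.H (M.Q j t) = M.Q j (M.Treg j 0 t) + t (Fin.last j) • (M.lanczos (j + 1)).2 := by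
  have h1 : M.Q j (M.Treg j 0 t) = ∑ b, t b • ∑ a, M.T j a b • M.q a := by
    simp only [Q, Treg_zero_apply, Finset.sum_smul, Finset.smul_sum, smul_smul]
    rw [Finset.sum_comm]
    refine Finset.sum_congr rfl fun a _ => Finset.sum_congr rfl fun b _ => ?_
    rw [mul_comm]
  rw [h1]
  simp only [sum_T_smul_q, smul_sub, Finset.sum_sub_distrib, Q, map_sum, map_smul, smul_ite,
    smul_zero]
  simp

lemma Q_add (j : ℕ) (u v : Vec (j + 1)) : M.Q j (u + v) = M.Q j u + M.Q j v := by
  simp [Q, add_smul, Finset.sum_add_distrib]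

lemma Q_smul (j : ℕ) (a : ℝ) (u : Vec (j + 1)) : M.Q j (a • u) = a • M.Q j u := by
  simp [Q, Finset.smul_sum, smul_smul]

lemma Q_rhs (j : ℕ) : M.Q j (M.rhs j) = M.g := by
  have : M.Q j (M.rhs j) = M.gam 0 • M.q 0 := by
    rw [Q, Finset.sum_eq_single 0]
    · simp [rhs]
    · intro i _ hi; simp [rhs, hi]
    · simp
  rw [this, gam_smul_q]; rfl

/-- The full-space residual of a stationary reduced pair is the scaled next Lanczos residual. -/
lemma full_residual {j : ℕ} {t : Vec (j + 1)} {lam : ℝ} (h : M.rhs j + M.Treg j lam t = 0) :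
    M.g + M.H (M.Q j t) + lam • M.Q j t = t (Fin.last j) • (M.lanczos (j + 1)).2 := by
  have h0 : M.Q j (M.rhs j + M.Treg j lam t) = 0 := by rw [h]; simp [Q]
  rw [Treg_apply, Q_add, Q_add, Q_smul, Q_rhs] at h0
  rw [H_Q]
  calc _ = (M.g + (M.Q j (M.Treg j 0 t) + lam • M.Q j t)) +
        t (Fin.last j) • (M.lanczos (j + 1)).2 := by abel
    _ = _ := by rw [h0, zero_add]

lemma norm_full_residual {j : ℕ} {t : Vec (j + 1)} {lam : ℝ}
    (h : M.rhs j + M.Treg j lam t = 0) :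
    ‖M.g + M.H (M.Q j t) + lam • M.Q j t‖ = M.mu j t := by
  rw [M.full_residual h, norm_smul, mu, gam, mul_comm, Real.norm_eq_abs]

/-! ### Isometry of `Q_j` before breakdown -/

section Orthonormal

variable {M}

lemma inner_Q (hH : ∀ u v, inner ℝ (M.H u) v = inner ℝ u (M.H v)) {j : ℕ}
    (hj : ∀ i ≤ j, M.gam i ≠ 0) (u v : Vec (j + 1)) : inner ℝ (M.Q j u) (M.Q j v) = (inner ℝ u v : ℝ) := by
  have ho := (M.orthonormal_lanczos hH j hj).1
  have : Orthonormal ℝ fun i : Fin (j + 1) => M.q i := by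
    rw [orthonormal_iff_ite]
    intro a b
    rw [ho a (by omega) b (by omega)]
    simp [Fin.ext_iff]
  rw [Q, Q, this.inner_sum]
  simp [PiLp.inner_apply, mul_comm]

lemma norm_Q (hH : ∀ u v, inner ℝ (M.H u) v = inner ℝ u (M.H v)) {j : ℕ}
    (hj : ∀ i ≤ j, M.gam i ≠ 0) (t : Vec (j + 1)) : ‖M.Q j t‖ = ‖t‖ := by
  rw [norm_eq_sqrt_real_inner, norm_eq_sqrt_real_inner, inner_Q hH hj]

lemma inner_Q_residual (hH : ∀ u v, inner ℝ (M.H u) v = inner ℝ u (M.H v)) {j : ℕ}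
    (hj : ∀ i ≤ j, M.gam i ≠ 0) (t : Vec (j + 1)) :
    inner ℝ (M.Q j t) (M.lanczos (j + 1)).2 = (0 : ℝ) := by
  rw [Q, sum_inner]
  refine Finset.sum_eq_zero fun i _ => ?_
  rw [inner_smul_left, (M.orthonormal_lanczos hH j hj).2 i (by omega), mul_zero]

lemma inner_g_Q (hH : ∀ u v, inner ℝ (M.H u) v = inner ℝ u (M.H v)) {j : ℕ}
    (hj : ∀ i ≤ j, M.gam i ≠ 0) (t : Vec (j + 1)) : inner ℝ M.g (M.Q j t) = (inner ℝ (M.rhs j) t : ℝ) := by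
  rw [← M.Q_rhs j, inner_Q hH hj]

lemma inner_Q_H_Q (hH : ∀ u v, inner ℝ (M.H u) v = inner ℝ u (M.H v)) {j : ℕ}
    (hj : ∀ i ≤ j, M.gam i ≠ 0) (t : Vec (j + 1)) :
    inner ℝ (M.Q j t) (M.H (M.Q j t)) = (inner ℝ t (M.Treg j 0 t) : ℝ) := by
  rw [H_Q, inner_add_right, inner_smul_right, inner_Q hH hj, inner_Q_residual hH hj, mul_zero,
    add_zero]

end Orthonormal

/-- What the analysis uses about the pairs `(t, λ)` met in FDS: first-order stationarity, a
nonnegative multiplier, and that `t` is a non-ascent direction. -/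
structure IsStep (j : ℕ) (t : Vec (j + 1)) (lam : ℝ) : Prop where
  stationary : M.rhs j + M.Treg j lam t = 0
  nonneg : 0 ≤ lam
  inner_nonpos : inner ℝ (M.rhs j) t ≤ (0 : ℝ)

variable {M}

/-- The ball and the quadratic term are even, so comparing a minimizer `t` with `-t` forces the
linear term to be nonpositive. -/
lemma obj_neg (j : ℕ) (lam : ℝ) (t : Vec (j + 1)) :
    M.obj j lam (-t) = M.obj j lam t - 2 * inner ℝ (M.rhs j) t := by
  simp only [obj, map_neg, inner_neg_right, inner_neg_left, neg_neg]; ring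

lemma SolvesTR.isStep {j : ℕ} {δ : ℝ} {t : Vec (j + 1)} {lam : ℝ} (h : M.SolvesTR j δ t lam) :
    M.IsStep j t lam where
  stationary := h.stationary
  nonneg := h.nonneg
  inner_nonpos := by
    have := h.minimal (-t) (by simpa using h.feasible)
    rw [obj_neg] at this
    linarith

lemma SolvesReg.stationary {j : ℕ} {t : Vec (j + 1)} {lam : ℝ} (h : M.SolvesReg j lam t) :
    M.rhs j + M.Treg j lam t = 0 := by
  refine stationary_of_isMin_quadratic _ (fun u v => ?_) _ _ h
  rw [Treg_apply, M.Treg_apply j lam v, inner_add_left, inner_add_right, inner_Treg_zero,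
    inner_smul_left, inner_smul_right]
  simp

lemma SolvesReg.isStep {j : ℕ} {t : Vec (j + 1)} {lam : ℝ} (h : M.SolvesReg j lam t)
    (hlam : 0 ≤ lam) : M.IsStep j t lam where
  stationary := h.stationary
  nonneg := hlam
  inner_nonpos := by
    have := h (-t)
    rw [obj_neg] at this
    linarith

lemma SolvesReg.norm_le {j : ℕ} {t t' : Vec (j + 1)} {α β : ℝ} (h : M.SolvesReg j α t)
    (h' : M.rhs j + M.Treg j β t' = 0) (hαβ : α < β) : ‖t'‖ ≤ ‖t‖ := by
  refine norm_le_of_regularized (M.Treg j 0) (M.inner_Treg_zero j) (M.rhs j) t t' hαβ ?_ ?_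
  · intro u
    have := h u
    simp only [obj] at this
    rwa [Treg_apply, M.Treg_apply j α u] at this
  · rwa [Treg_apply] at h'

lemma IsStep.ne_zero {j : ℕ} {t : Vec (j + 1)} {lam : ℝ} (h : M.IsStep j t lam)
    (h0 : M.gam 0 ≠ 0) : t ≠ 0 := by
  rintro rfl
  have := h.stationary
  simp [rhs, h0] at this

/-- The full-space quadratic model decreases by at least `λ ‖t‖² / 2` along `Q_j t`. -/
lemma IsStep.model_le {j : ℕ} {t : Vec (j + 1)} {lam : ℝ} (h : M.IsStep j t lam)
    (hH : ∀ u v, inner ℝ (M.H u) v = inner ℝ u (M.H v)) (hj : ∀ i ≤ j, M.gam i ≠ 0) :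
    inner ℝ M.g (M.Q j t) + 1 / 2 * inner ℝ (M.Q j t) (M.H (M.Q j t)) ≤
      -(1 / 2 * lam * ‖t‖ ^ 2) := by
  rw [inner_g_Q hH hj, inner_Q_H_Q hH hj]
  have h1 : inner ℝ t (M.rhs j + M.Treg j lam t) = (0 : ℝ) := by
    rw [h.stationary, inner_zero_right]
  rw [Treg_apply, inner_add_right, inner_add_right, inner_smul_right, real_inner_self_eq_norm_sq,
    real_inner_comm] at h1
  linarith [h.inner_nonpos]

/-- At breakdown `μ = 0` and the first accuracy test passes. Hence the Krylov space is enlarged only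
when the next Lanczos vector is well defined. -/
lemma gam_succ_ne_zero_of_not_accurate {P : Params} {j : ℕ} {t : Vec (j + 1)} {lam : ℝ}
    (h : ¬ M.Accurate P j t lam) : M.gam (j + 1) ≠ 0 := by
  intro h0
  refine h (Or.inl ?_)
  rw [mu, h0, zero_mul]
  exact mul_nonneg P.ξ₁_pos.le (sq_nonneg _)

end Local

/-! ### Taylor estimates under a Lipschitz Hessian -/

section Taylor

variable {n : ℕ} {f : Vec n → ℝ}

lemma differentiable_gradient (hf : ContDiff ℝ 2 f) : Differentiable ℝ (∇ f) := by
  have h1 : Differentiable ℝ (fderiv ℝ f) :=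
    (hf.fderiv_right (m := 1) (by norm_num)).differentiable (by norm_num)
  exact (InnerProductSpace.toDual ℝ (Vec n)).symm.toContinuousLinearEquiv.differentiable.comp h1

lemma hess_symm (hf : ContDiff ℝ 2 f) (x u v : Vec n) :
    inner ℝ (hess f x u) v = (inner ℝ u (hess f x v) : ℝ) := by
  have h1 : DifferentiableAt ℝ (fderiv ℝ f) x :=
    (hf.fderiv_right (m := 1) (by norm_num)).differentiable (by norm_num) x
  have h2 : ∀ w, hess f x w =
      (InnerProductSpace.toDual ℝ (Vec n)).symm (fderiv ℝ (fderiv ℝ f) x w) := by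
    intro w
    have := ((InnerProductSpace.toDual ℝ
      (Vec n)).symm.toContinuousLinearEquiv.hasFDerivAt.comp x h1.hasFDerivAt).fderiv
    have h3 : hess f x = _ := this
    rw [h3]; rfl
  have h4 : IsSymmSndFDerivAt ℝ f x :=
    hf.contDiffAt.isSymmSndFDerivAt (by simp)
  rw [real_inner_comm _ u, h2, h2, InnerProductSpace.toDual_symm_apply,
    InnerProductSpace.toDual_symm_apply]
  exact h4 u v

variable {U : Set (Vec n)} {L : ℝ}

/-- The error has derivative `(H(x + τ s) - H(x)) s` in `τ`, of norm at most `L ‖s‖² τ`; integrating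
gives the factor `½`. Convexity keeps the segment inside `U`. -/
lemma norm_gradient_sub_linearization_le (hf : ContDiff ℝ 2 f) (hU : Convex ℝ U)
    (hL : ∀ x ∈ U, ∀ y ∈ U, ‖hess f x - hess f y‖ ≤ L * ‖x - y‖) {x s : Vec n}
    (hx : x ∈ U) (hs : x + s ∈ U) :
    ∀ τ ∈ Set.Icc (0 : ℝ) 1,
      ‖∇ f (x + τ • s) - ∇ f x - τ • hess f x s‖ ≤ 1 / 2 * L * ‖s‖ ^ 2 * τ ^ 2 := by
  have hline : ∀ τ : ℝ, HasDerivAt (fun τ : ℝ => x + τ • s) s τ := fun τ => by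
    simpa using ((hasDerivAt_id τ).smul_const s).const_add x
  have hd : ∀ τ : ℝ, HasDerivAt (fun τ : ℝ => ∇ f (x + τ • s) - ∇ f x - τ • hess f x s)
      (hess f (x + τ • s) s - hess f x s) τ := fun τ => by
    have h1 := ((differentiable_gradient hf (x + τ • s)).hasFDerivAt.comp_hasDerivAt τ
      (hline τ)).sub_const (∇ f x)
    have h2 := (hasDerivAt_id τ).smul_const (hess f x s)
    rw [one_smul] at h2
    exact h1.sub h2
  intro τ hτ
  refine image_norm_le_of_norm_deriv_right_le_deriv_boundary
    (f := fun τ : ℝ => ∇ f (x + τ • s) - ∇ f x - τ • hess f x s)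
    (B := fun τ => 1 / 2 * L * ‖s‖ ^ 2 * τ ^ 2)
    (B' := fun τ => L * ‖s‖ ^ 2 * τ)
    (fun t _ => (hd t).continuousAt.continuousWithinAt)
    (fun t _ => (hd t).hasDerivWithinAt) (by simp) ?_ ?_ hτ
  · intro t
    refine ((hasDerivAt_pow 2 t).const_mul (1 / 2 * L * ‖s‖ ^ 2)).congr_deriv ?_
    norm_num; ring
  · intro t ht
    have hmem : x + t • s ∈ U := hU.add_smul_mem hx hs ⟨ht.1, ht.2.le⟩
    rw [← sub_apply]
    refine (ContinuousLinearMap.le_opNorm _ _).trans ?_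
    have := hL _ hmem _ hx
    rw [add_sub_cancel_left, norm_smul, Real.norm_of_nonneg ht.1] at this
    nlinarith [norm_nonneg s]

/-- Cubic upper bound (with a non-sharp constant) for a function with Lipschitz Hessian. -/
lemma le_quadratic_model_add_cubic (hf : ContDiff ℝ 2 f) (hU : Convex ℝ U) (hL0 : 0 ≤ L)
    (hL : ∀ x ∈ U, ∀ y ∈ U, ‖hess f x - hess f y‖ ≤ L * ‖x - y‖) {x s : Vec n}
    (hx : x ∈ U) (hs : x + s ∈ U) :
    f (x + s) ≤ f x + (inner ℝ (∇ f x) s + 1 / 2 * inner ℝ s (hess f x s))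
      + 1 / 2 * L * ‖s‖ ^ 3 := by
  have hline : ∀ τ : ℝ, HasDerivAt (fun τ : ℝ => x + τ • s) s τ := fun τ => by
    simpa using ((hasDerivAt_id τ).smul_const s).const_add x
  -- `φ 1 - φ 0` is the second-order Taylor remainder, and `φ'` pairs the linearization error of the
  -- gradient with `s`. Bounding `τ²` by 1 below costs the sharp constant `1/6` but suffices for
  -- `HLip + 2η`.
  set φ : ℝ → ℝ := fun τ => f (x + τ • s) - τ * inner ℝ (∇ f x) s
    - τ ^ 2 * (1 / 2 * inner ℝ s (hess f x s)) with hφ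
  have hd : ∀ τ : ℝ, HasDerivAt φ
      (inner ℝ (∇ f (x + τ • s) - ∇ f x - τ • hess f x s) s) τ := fun τ => by
    have h0 : HasFDerivAt f (InnerProductSpace.toDual ℝ (Vec n) (∇ f (x + τ • s))) (x + τ • s) :=
      (hf.differentiable (by norm_num) (x + τ • s)).hasGradientAt.hasFDerivAt
    have h1 := h0.comp_hasDerivAt τ (hline τ)
    have h2 := (hasDerivAt_id τ).mul_const (inner ℝ (∇ f x) s : ℝ)
    have h3 := (hasDerivAt_pow 2 τ).mul_const (1 / 2 * inner ℝ s (hess f x s) : ℝ)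
    refine ((h1.sub h2).sub h3).congr_deriv ?_
    rw [InnerProductSpace.toDual_apply_apply, inner_sub_left, inner_sub_left, inner_smul_left,
      real_inner_comm s (hess f x s)]
    simp; ring
  have hb := norm_image_sub_le_of_norm_deriv_le_segment_01' (f := φ)
    (C := 1 / 2 * L * ‖s‖ ^ 3) (fun τ _ => (hd τ).hasDerivWithinAt) (fun τ hτ => by
      have h1 := norm_gradient_sub_linearization_le hf hU hL hx hs τ ⟨hτ.1, hτ.2.le⟩
      refine (norm_inner_le_norm _ _).trans ?_
      have h2 : 1 / 2 * L * ‖s‖ ^ 2 * τ ^ 2 ≤ 1 / 2 * L * ‖s‖ ^ 2 :=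
        mul_le_of_le_one_right (by positivity) (pow_le_one₀ hτ.1 hτ.2.le)
      calc _ ≤ 1 / 2 * L * ‖s‖ ^ 2 * ‖s‖ :=
            mul_le_mul_of_nonneg_right (h1.trans h2) (norm_nonneg _)
        _ = _ := by ring)
  have := (le_abs_self _).trans hb
  simp only [hφ, one_smul, zero_smul, add_zero] at this
  linarith

end Taylor

/-- The constant relating `‖s_k‖²` to `‖∇ f (x_{k+1})‖`. -/
def stepConst (P : Params) (σ₀ gLip HLip : ℝ) : ℝ :=
  1 / 2 * HLip + sigMax P σ₀ HLip + max P.ξ₁ (P.ξ₂ * gLip)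

/-- The decrease of `f` guaranteed by an accepted step that ends at a point that is not
`ε`-stationary. -/
def decrease (P : Params) (σ₀ gLip HLip ε : ℝ) : ℝ :=
  P.η * (1 - P.ξ₂) ^ (3 / 2 : ℝ) * ε ^ (3 / 2 : ℝ) / stepConst P σ₀ gLip HLip ^ (3 / 2 : ℝ)

lemma sigMax_pos (P : Params) (σ₀ HLip : ℝ) : 0 < sigMax P σ₀ HLip :=
  (P.sigLo_pos.trans P.sigLo_lt).trans_le ((le_max_left _ _).trans (le_max_right _ _))

lemma stepConst_pos (P : Params) (σ₀ gLip : ℝ) {HLip : ℝ} (hH : 0 < HLip) :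
    0 < stepConst P σ₀ gLip HLip := by
  have := sigMax_pos P σ₀ HLip
  have := P.ξ₁_pos.trans_le (le_max_left P.ξ₁ (P.ξ₂ * gLip))
  rw [stepConst]
  positivity

lemma decrease_pos (P : Params) (σ₀ gLip : ℝ) {HLip ε : ℝ} (hH : 0 < HLip) (hε : 0 < ε) :
    0 < decrease P σ₀ gLip HLip ε := by
  have h1 := stepConst_pos P σ₀ gLip hH
  have h2 := P.η_mem.1
  have h3 := sub_pos.2 P.ξ₂_mem.2
  rw [decrease]
  positivity

/-- The assumptions on the objective. -/
structure Smooth {n : ℕ} (f : Vec n → ℝ) (U : Set (Vec n)) (gLip HLip : ℝ) : Prop where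
  contDiff : ContDiff ℝ 2 f
  convex : Convex ℝ U
  gLip_nonneg : 0 ≤ gLip
  HLip_pos : 0 < HLip
  grad_lip : ∀ x ∈ U, ∀ y ∈ U, ‖∇ f x - ∇ f y‖ ≤ gLip * ‖x - y‖
  hess_lip : ∀ x ∈ U, ∀ y ∈ U, ‖hess f x - hess f y‖ ≤ HLip * ‖x - y‖

/-- The derivative data of `f` at `x`. -/
def dataAt {n : ℕ} (f : Vec n → ℝ) (x : Vec n) : Local n := ⟨∇ f x, hess f x⟩

/-- `M` holds the derivative data at `x` and the Lanczos process has not broken down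
up to index `j`. -/
def Regular {n : ℕ} (f : Vec n → ℝ) (x : Vec n) (M : Local n) (j : ℕ) : Prop :=
  M = dataAt f x ∧ ∀ i ≤ j, M.gam i ≠ 0

/-! ### Consequences of rejecting and of accepting a trial step -/

section Regular

variable {n : ℕ} {f : Vec n → ℝ} {x : Vec n} {M : Local n} {j : ℕ}

lemma Regular.succ (h : Regular f x M j) (hj : M.gam (j + 1) ≠ 0) : Regular f x M (j + 1) :=
  ⟨h.1, fun i hi => by
    rcases hi.lt_or_eq with hlt | rfl
    · exact h.2 i (by omega)
    · exact hj⟩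

lemma Regular.symm (h : Regular f x M j) (hf : ContDiff ℝ 2 f) (u v : Vec n) :
    inner ℝ (M.H u) v = (inner ℝ u (M.H v) : ℝ) := by
  rw [h.1]; exact hess_symm hf x u v

lemma Regular.norm_pos (h : Regular f x M j) {t : Vec (j + 1)} {lam : ℝ}
    (hs : M.IsStep j t lam) : 0 < ‖t‖ :=
  norm_pos_iff.2 (hs.ne_zero (h.2 0 (Nat.zero_le _)))

variable {U : Set (Vec n)} {gLip HLip : ℝ} {t : Vec (j + 1)} {lam : ℝ}

/-- A rejected trial step has a small ratio `λ / ‖t‖`. -/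
lemma Regular.ratio_lt_of_rho_lt (h : Regular f x M j) (hf : Smooth f U gLip HLip) {η : ℝ}
    (hs : M.IsStep j t lam) (hx : x ∈ U) (hxt : x + M.Q j t ∈ U)
    (hρ : rho f x (M.Q j t) < η) : lam < (HLip + 2 * η) * ‖t‖ := by
  have hsym := h.symm hf.contDiff
  have ht := h.norm_pos hs
  have hm := hs.model_le hsym h.2
  have hT := le_quadratic_model_add_cubic hf.contDiff hf.convex hf.HLip_pos.le hf.hess_lip hx hxt
  have hn := Local.norm_Q hsym h.2 t
  rw [rho, hn, div_lt_iff₀ (by positivity)] at hρ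
  rw [hn] at hT
  have h2 : inner ℝ M.g (M.Q j t) = (inner ℝ (∇ f x) (M.Q j t) : ℝ) := by rw [h.1]; rfl
  have h3 : M.H (M.Q j t) = hess f x (M.Q j t) := by rw [h.1]; rfl
  rw [h2, h3] at hm
  -- Twice the inequality `½ λ ‖t‖² - ½ HLip ‖t‖³ < η ‖t‖³`: model decrease minus Taylor error,
  -- against the failed ratio test.
  have h4 : 0 < ((HLip + 2 * η) * ‖t‖ - lam) * ‖t‖ ^ 2 := by nlinarith
  have := pos_of_mul_pos_left h4 (by positivity)
  linarith

/-- The gradient at the end of an accurate step is bounded by the squared step length. -/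
lemma Regular.gradient_le (h : Regular f x M j) (hf : Smooth f U gLip HLip) {P : Params}
    {σ₀ σ : ℝ} (hs : M.IsStep j t lam) (hx : x ∈ U) (hxt : x + M.Q j t ∈ U)
    (hr : lam / ‖t‖ ≤ σ) (hσ : σ ≤ sigMax P σ₀ HLip) (ha : M.Accurate P j t lam) :
    (1 - P.ξ₂) * ‖∇ f (x + M.Q j t)‖ ≤ stepConst P σ₀ gLip HLip * ‖t‖ ^ 2 := by
  have ht := h.norm_pos hs
  have hn := Local.norm_Q (h.symm hf.contDiff) h.2 t
  set s := M.Q j t with hsdef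
  have hT := norm_gradient_sub_linearization_le hf.contDiff hf.convex hf.hess_lip hx hxt 1 (by simp)
  have hR := M.norm_full_residual hs.stationary
  have hg : M.g = ∇ f x := by rw [h.1]; rfl
  have hH : M.H s = hess f x s := by rw [h.1]; rfl
  rw [← hsdef, hg, hH] at hR
  rw [one_smul, one_smul, hn] at hT
  have hlam : ‖lam • s‖ ≤ sigMax P σ₀ HLip * ‖t‖ ^ 2 := by
    rw [norm_smul, hn, Real.norm_of_nonneg hs.nonneg]
    have := (div_le_iff₀ ht).1 (hr.trans hσ)
    nlinarith
  have htri : ‖∇ f (x + s)‖ ≤ 1 / 2 * HLip * ‖t‖ ^ 2 + M.mu j t + sigMax P σ₀ HLip * ‖t‖ ^ 2 := by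
    have e : ∇ f (x + s) = (∇ f (x + s) - ∇ f x - hess f x s)
        + (∇ f x + hess f x s + lam • s) - lam • s := by abel
    rw [e]
    refine (norm_sub_le _ _).trans (add_le_add ((norm_add_le _ _).trans (add_le_add ?_ hR.le)) hlam)
    linarith
  have hξ := P.ξ₂_mem
  have hG := norm_nonneg (∇ f (x + s))
  rw [stepConst]
  rcases ha with ha | ⟨ha, -⟩
  · have : P.ξ₁ * ‖t‖ ^ 2 ≤ max P.ξ₁ (P.ξ₂ * gLip) * ‖t‖ ^ 2 :=
      mul_le_mul_of_nonneg_right (le_max_left _ _) (by positivity)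
    nlinarith [mul_nonneg hξ.1.le hG]
  · have h1 : P.ξ₂ * gLip * ‖t‖ ^ 2 ≤ max P.ξ₁ (P.ξ₂ * gLip) * ‖t‖ ^ 2 :=
      mul_le_mul_of_nonneg_right (le_max_right _ _) (by positivity)
    have h2 : M.gam 0 ≤ ‖∇ f (x + s)‖ + gLip * ‖t‖ := by
      have h3 := hf.grad_lip x hx _ hxt
      rw [sub_add_cancel_left, norm_neg, hn] at h3
      have h4 := norm_sub_norm_le (∇ f x) (∇ f (x + s))
      have h5 : M.gam 0 = ‖∇ f x‖ := by rw [← hg]; rfl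
      linarith
    have hm0 : 0 ≤ min 1 ‖t‖ := le_min zero_le_one ht.le
    -- The minimum is bounded by 1 on the gradient term and by `‖t‖` on the Lipschitz term. After
    -- multiplication by `ξ₂` the former is absorbed on the left, which gives the factor `1 - ξ₂`.
    have h6 : min 1 ‖t‖ * M.gam 0 ≤ ‖∇ f (x + s)‖ + gLip * ‖t‖ * ‖t‖ := by
      have hgl := mul_nonneg hf.gLip_nonneg ht.le
      calc _ ≤ min 1 ‖t‖ * (‖∇ f (x + s)‖ + gLip * ‖t‖) := mul_le_mul_of_nonneg_left h2 hm0
        _ = min 1 ‖t‖ * ‖∇ f (x + s)‖ + gLip * ‖t‖ * min 1 ‖t‖ := by ring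
        _ ≤ _ := add_le_add (mul_le_of_le_one_left hG (min_le_left _ _))
          (mul_le_mul_of_nonneg_left (min_le_right _ _) hgl)
    nlinarith [mul_le_mul_of_nonneg_left h6 hξ.1.le]

/-- Decrease of the objective at an accepted step. -/
lemma Regular.decrease_le (h : Regular f x M j) (hf : Smooth f U gLip HLip) {P : Params}
    {σ₀ σ ε : ℝ} (hs : M.IsStep j t lam) (hx : x ∈ U) (hxt : x + M.Q j t ∈ U)
    (hr : lam / ‖t‖ ≤ σ) (hσ : σ ≤ sigMax P σ₀ HLip) (ha : M.Accurate P j t lam)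
    (hρ : P.η ≤ rho f x (M.Q j t)) (hε0 : 0 < ε) (hε : ε < ‖∇ f (x + M.Q j t)‖) :
    decrease P σ₀ gLip HLip ε ≤ f x - f (x + M.Q j t) := by
  have ht := h.norm_pos hs
  have hC := stepConst_pos P σ₀ gLip hf.HLip_pos
  have hξ := sub_pos.2 P.ξ₂_mem.2
  have hg := h.gradient_le hf hs hx hxt hr hσ ha
  rw [rho, Local.norm_Q (h.symm hf.contDiff) h.2, le_div_iff₀ (by positivity)] at hρ
  refine le_trans ?_ hρ
  have h1 : (1 - P.ξ₂) * ε ≤ stepConst P σ₀ gLip HLip * ‖t‖ ^ 2 :=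
    (mul_le_mul_of_nonneg_left hε.le hξ.le).trans hg
  -- The power `3/2` turns `‖t‖²` into the `‖t‖³` of the ratio test.
  have h2 := Real.rpow_le_rpow (by positivity) h1 (by norm_num : (0 : ℝ) ≤ 3 / 2)
  rw [Real.mul_rpow hξ.le hε0.le, Real.mul_rpow hC.le (by positivity)] at h2
  have h3 : (‖t‖ ^ 2) ^ (3 / 2 : ℝ) = ‖t‖ ^ 3 := by
    rw [← Real.rpow_natCast ‖t‖ 2, ← Real.rpow_mul ht.le, ← Real.rpow_natCast ‖t‖ 3]
    norm_num
  rw [h3] at h2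
  rw [decrease, div_le_iff₀ (by positivity)]
  nlinarith [mul_le_mul_of_nonneg_left h2 P.η_mem.1.le]

end Regular

/-- The part of the run invariant that concerns the control location. -/
def PhaseOK (P : Params) {n : ℕ} (f : Vec n → ℝ) (U : Set (Vec n)) (σmax : ℝ) (x : Vec n) :
    Phase n → Prop
  | .start => True
  | .tltr M j => Regular f x M j
  | .fds M j t lam δl σl => Regular f x M j ∧ M.IsStep j t lam ∧ ‖t‖ ≤ δl ∧ σl ≤ σmax
  | .check M j t lam _ σbar => Regular f x M j ∧ M.IsStep j t lam ∧ σbar ≤ σmax ∧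
      lam / ‖t‖ ≤ σbar ∧ P.η ≤ rho f x (M.Q j t) ∧ x + M.Q j t ∈ U

/-- The run invariant. -/
def Config.OK (P : Params) {n : ℕ} (f : Vec n → ℝ) (U : Set (Vec n)) (σmax : ℝ)
    (c : Config n) : Prop :=
  c.σ ≤ σmax ∧ PhaseOK P f U σmax c.x c.phase

/-! ### The uniform bound on `σ` and the run invariant -/

section Invariant

variable {P : Params} {n : ℕ} {f : Vec n → ℝ} {U : Set (Vec n)} {σ₀ gLip HLip : ℝ}

/-- Serves both contractions of a multiplier that is not small, with `r` the norm of the new step.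
Rejection bounds the old ratio by `HLip + 2η`, and the new ratio exceeds the old one by a factor of
at most `γL / γC`. -/
lemma scaled_ratio_le (hf : Smooth f U gLip HLip) {x : Vec n} {M : Local n} {j : ℕ}
    (h : Regular f x M j) {t : Vec (j + 1)} {lam δl : ℝ} (hs : M.IsStep j t lam)
    (hδ : ‖t‖ ≤ δl) (hx : x ∈ U) (hxt : x + M.Q j t ∈ U) (hρ : rho f x (M.Q j t) < P.η)
    {r lam' : ℝ} (hr : P.γC * δl ≤ r) (hlam' : lam' ≤ P.γL * lam) :
    lam' / r ≤ sigMax P σ₀ HLip := by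
  have hlt := h.ratio_lt_of_rho_lt hf hs hx hxt hρ
  have ht := h.norm_pos hs
  have hC := P.γC_mem.1
  have hL : 0 < P.γL := zero_lt_one.trans P.one_lt_γL
  have hη := P.η_mem.1
  have hH := hf.HLip_pos
  have hr' : P.γC * ‖t‖ ≤ r := (mul_le_mul_of_nonneg_left hδ hC.le).trans hr
  have hr0 : 0 < r := (mul_pos hC ht).trans_le hr'
  refine le_trans ?_ ((le_max_right _ _).trans (le_max_right _ _))
  rw [div_le_iff₀ hr0]
  calc lam' ≤ P.γL * ((HLip + 2 * P.η) * ‖t‖) := hlam'.trans (by gcongr)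
    _ = P.γL / P.γC * (HLip + 2 * P.η) * (P.γC * ‖t‖) := by field_simp
    _ ≤ _ := by gcongr

/-- The invariant is preserved by every step. -/
lemma Config.OK.step (hf : Smooth f U gLip HLip) {c c' : Config n}
    (h : c.OK P f U (sigMax P σ₀ HLip)) (hc : c.points ⊆ U) (hg : ∇ f c.x ≠ 0)
    (hstep : Step P f c c') : c'.OK P f U (sigMax P σ₀ HLip) := by
  obtain ⟨hσ, hph⟩ := h
  have hHi : P.sigHi ≤ sigMax P σ₀ HLip := (le_max_left _ _).trans (le_max_right _ _)
  cases hstep with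
  | begin hp =>
    refine ⟨hσ, rfl, fun i hi => ?_⟩
    obtain rfl : i = 0 := by omega
    exact norm_ne_zero_iff.2 hg
  | tltr_continue M j t lam hp hs ha =>
    rw [hp] at hph
    exact ⟨hσ, Regular.succ hph (Local.gam_succ_ne_zero_of_not_accurate ha)⟩
  | tltr_return M j t lam hp hs ha =>
    rw [hp] at hph
    exact ⟨hσ, hph, hs.isStep, hs.feasible, hσ⟩
  | fds_return M j t lam δl σl hp hρ hr =>
    rw [hp] at hph
    simp only [Config.points, hp] at hc
    exact ⟨hσ, hph.1, hph.2.1, hph.2.2.2, hr, hρ, hc (by simp)⟩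
  | fds_expand M j t lam δl σl t' lam' hp hρ hr hs =>
    rw [hp] at hph
    exact ⟨hσ, hph.1, hs.isStep, hs.feasible, hph.2.2.2⟩
  | fds_contract_small M j t lam δl σl t' lam' hp hρ hr hlam hs hr' =>
    rw [hp] at hph
    refine ⟨hσ, hph.1, hs.isStep ?_, le_rfl, max_le hph.2.2.2 (hr'.trans hHi)⟩
    rw [hlam]
    exact add_nonneg hph.2.1.nonneg (Real.sqrt_nonneg _)
  | fds_contract_between M j t lam δl σl that lamhat t' lam' hp hρ hr hlam hhat hr' hmem hs hb =>
    rw [hp] at hph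
    exact ⟨hσ, hph.1, hs.isStep (hph.2.1.nonneg.trans hmem.1.le), le_rfl,
      max_le hph.2.2.2 (hb.2.le.trans hHi)⟩
  | fds_contract_scale M j t lam δl σl t' lam' hp hρ hr hlam hs hn =>
    rw [hp] at hph
    simp only [Config.points, hp] at hc
    refine ⟨hσ, hph.1, hs.isStep ?_, le_rfl, max_le hph.2.2.2 ?_⟩
    · rw [hlam]
      exact mul_nonneg (zero_lt_one.trans P.one_lt_γL).le hph.2.1.nonneg
    · exact scaled_ratio_le hf hph.1 hph.2.1 hph.2.2.1 (hc (by simp)) (hc (by simp)) hρ hn hlam.le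
  | fds_contract_radius M j t lam δl σl that t' lam' hp hρ hr hhat hn hs =>
    rw [hp] at hph
    simp only [Config.points, hp] at hc
    refine ⟨hσ, hph.1, hs.isStep, hs.feasible, max_le hph.2.2.2 ?_⟩
    -- A zero multiplier gives ratio 0; a positive one makes the constraint active, so the step has
    -- norm exactly `γC δl`.
    rcases hs.nonneg.eq_or_lt with h0 | hpos
    · rw [← h0, zero_div]; exact (sigMax_pos _ _ _).le
    · have hnorm : P.γC * δl = ‖t'‖ := by
        have := (mul_eq_zero.1 hs.complementary).resolve_left hpos.ne'
        linarith
      refine scaled_ratio_le hf hph.1 hph.2.1 hph.2.2.1 (hc (by simp)) (hc (by simp)) hρ hnorm.le ?_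
      -- A multiplier above `γL λ` would force `‖t'‖ ≤ ‖that‖ < γC δl`, contradicting the active
      -- constraint.
      by_contra! hlt
      have := hhat.norm_le hs.stationary hlt
      linarith
  | accept M j t lam δbar σbar hp ha =>
    rw [hp] at hph
    exact ⟨hph.2.2.1, trivial⟩
  | enlarge M j t lam δbar σbar t' lam' hp ha hs =>
    rw [hp] at hph
    exact ⟨hσ, Regular.succ hph.1 (Local.gam_succ_ne_zero_of_not_accurate ha), hs.isStep,
      hs.feasible, hσ⟩

/-- The effect of a step on the quantities that are counted. -/
lemma Config.OK.step_cases (hf : Smooth f U gLip HLip) {c c' : Config n}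
    (h : c.OK P f U (sigMax P σ₀ HLip)) (hc : c.points ⊆ U)
    (hstep : Step P f c c') {ε : ℝ} (hε : 0 < ε) :
    (c.phase = .start ∧ c'.phase ≠ .start ∧ c'.k = c.k ∧ c'.x = c.x ∧
        c'.gradLog = c.x :: c.gradLog) ∨
      (c.phase ≠ .start ∧ c'.phase ≠ .start ∧ c'.k = c.k ∧ c'.x = c.x ∧
        c'.gradLog = c.gradLog) ∨
      (c.phase ≠ .start ∧ c'.phase = .start ∧ c'.k = c.k + 1 ∧ f c'.x ≤ f c.x ∧
        c'.gradLog = c.gradLog ∧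
        (ε < ‖∇ f c'.x‖ → decrease P σ₀ gLip HLip ε ≤ f c.x - f c'.x)) := by
  obtain ⟨-, hph⟩ := h
  cases hstep with
  | begin hp => exact Or.inl ⟨hp, by simp, rfl, rfl, rfl⟩
  | accept M j t lam δbar σbar hp ha =>
    rw [hp] at hph
    obtain ⟨h1, h2, h3, h4, h5, h6⟩ := hph
    refine Or.inr (Or.inr ⟨by simp [hp], rfl, rfl, ?_, rfl, fun hlt => ?_⟩)
    · have ht := h1.norm_pos h2
      rw [rho, Local.norm_Q (h1.symm hf.contDiff) h1.2, le_div_iff₀ (by positivity)] at h5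
      have := mul_pos P.η_mem.1 (pow_pos ht 3)
      simp only
      linarith
    · have hx : c.x ∈ U := by
        simp only [Config.points, hp] at hc
        exact hc rfl
      exact h1.decrease_le hf h2 hx h6 h4 h3 ha h5 hε hlt
  | _ => exact Or.inr (Or.inl ⟨by simp [*], by simp, rfl, rfl, rfl⟩)

end Invariant

/-! ### Counting outer iterations and gradient evaluations -/

section Counting

variable {P : Params} {n : ℕ} {f : Vec n → ℝ} {U : Set (Vec n)} {σ₀ gLip HLip : ℝ}

open Classical in
/-- The outer iterations with `‖∇ f (x_k)‖ > ε` reached up to run index `i`. -/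
def reached (f : Vec n → ℝ) (run : ℕ → Config n) (ε : ℝ) (i : ℕ) : Finset ℕ :=
  ((Finset.range (i + 1)).filter fun m => ε < ‖∇ f (run m).x‖).image fun m => (run m).k

lemma mem_reached {run : ℕ → Config n} {ε : ℝ} {i k : ℕ} :
    k ∈ reached f run ε i ↔ ∃ m ≤ i, ε < ‖∇ f (run m).x‖ ∧ (run m).k = k := by
  simp [reached, and_assoc]

lemma reached_mono {run : ℕ → Config n} {ε : ℝ} {i i' : ℕ} (h : i ≤ i') :
    reached f run ε i ⊆ reached f run ε i' := by
  intro k hk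
  obtain ⟨m, hm, h'⟩ := mem_reached.1 hk
  exact mem_reached.2 ⟨m, hm.trans h, h'⟩

lemma reached_succ_of_not {run : ℕ → Config n} {ε : ℝ} {i : ℕ}
    (h : ¬ ε < ‖∇ f (run (i + 1)).x‖) : reached f run ε (i + 1) = reached f run ε i := by
  refine (Finset.Subset.antisymm ?_ (reached_mono (Nat.le_succ i)))
  intro k hk
  obtain ⟨m, hm, hε, hk⟩ := mem_reached.1 hk
  rcases hm.lt_or_eq with hlt | rfl
  · exact mem_reached.2 ⟨m, by omega, hε, hk⟩
  · exact absurd hε h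

lemma reached_succ {run : ℕ → Config n} {ε : ℝ} {i : ℕ}
    (h : ε < ‖∇ f (run (i + 1)).x‖) :
    reached f run ε (i + 1) = insert (run (i + 1)).k (reached f run ε i) := by
  ext k
  rw [Finset.mem_insert, mem_reached, mem_reached]
  constructor
  · rintro ⟨m, hm, hε, hk⟩
    rcases hm.lt_or_eq with hlt | rfl
    · exact Or.inr ⟨m, by omega, hε, hk⟩
    · exact Or.inl hk.symm
  · rintro (rfl | ⟨m, hm, hε, hk⟩)
    · exact ⟨i + 1, le_rfl, h, rfl⟩
    · exact ⟨m, by omega, hε, hk⟩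

lemma reached_succ_of_eq {run : ℕ → Config n} {ε : ℝ} {i : ℕ}
    (hk : (run (i + 1)).k = (run i).k) (hx : (run (i + 1)).x = (run i).x) :
    reached f run ε (i + 1) = reached f run ε i := by
  by_cases h : ε < ‖∇ f (run (i + 1)).x‖
  · rw [reached_succ h, Finset.insert_eq_self]
    exact mem_reached.2 ⟨i, le_rfl, hx ▸ h, hk.symm⟩
  · exact reached_succ_of_not h

open Classical in
/-- The evaluation about to happen at a configuration that starts an outer iteration at a
point that is not `ε`-stationary. -/
def pending (f : Vec n → ℝ) (ε : ℝ) (c : Config n) : ℕ :=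
  if c.phase = .start ∧ ε < ‖∇ f c.x‖ then 1 else 0

/-- The accounting behind the complexity bound: each element of `reached` beyond the first is
paid for by a decrease of `f`, and each counted gradient evaluation belongs to its own element. -/
theorem run_accounting (hf : Smooth f U gLip HLip) {x₀ : Vec n} {δ₀ : ℝ} {N : ℕ∞}
    {run : ℕ → Config n} (hσ₀ : σ₀ ≤ sigMax P σ₀ HLip) (hrun : IsRun P f x₀ δ₀ σ₀ N run)
    (hU : ∀ i : ℕ, (i : ℕ∞) ≤ N → (run i).points ⊆ U)
    (hg : ∀ i : ℕ, (i : ℕ∞) ≤ N → ∇ f (run i).x ≠ 0) {ε : ℝ} (hε : 0 < ε)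
    (i : ℕ) (hi : (i : ℕ∞) ≤ N) :
    (run i).OK P f U (sigMax P σ₀ HLip) ∧
      (∀ k ∈ reached f run ε i, k ≤ (run i).k) ∧
      decrease P σ₀ gLip HLip ε * (reached f run ε i).card ≤
        f x₀ - f (run i).x + decrease P σ₀ gLip HLip ε ∧
      (run i).gradEvals f ε + pending f ε (run i) ≤ (reached f run ε i).card := by
  have hD := decrease_pos P σ₀ gLip hf.HLip_pos hε
  induction i with
  | zero =>
    rw [hrun.1]
    refine ⟨⟨hσ₀, trivial⟩, ?_, ?_, ?_⟩
    · intro k hk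
      obtain ⟨m, hm, -, hk⟩ := mem_reached.1 hk
      obtain rfl : m = 0 := by omega
      rw [hrun.1] at hk
      exact hk.ge
    -- The additional `decrease` on the right-hand side pays for the starting point.
    · have : (reached f run ε 0).card ≤ 1 := by
        refine Finset.card_le_one.2 fun a ha b hb => ?_
        obtain ⟨m, hm, -, rfl⟩ := mem_reached.1 ha
        obtain ⟨m', hm', -, rfl⟩ := mem_reached.1 hb
        obtain rfl : m = 0 := by omega
        obtain rfl : m' = 0 := by omega
        rfl
      have h1 : ((reached f run ε 0).card : ℝ) ≤ 1 := by exact_mod_cast this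
      simp only [sub_self, zero_add]
      nlinarith
    · simp only [Config.gradEvals, List.countP_nil, pending, zero_add, true_and]
      split_ifs with h
      · refine Finset.card_pos.2 ⟨(run 0).k, mem_reached.2 ⟨0, le_rfl, ?_, rfl⟩⟩
        rwa [hrun.1]
      · exact Nat.zero_le _
  | succ i ih =>
    have hi' : (i : ℕ∞) ≤ N := le_trans (by exact_mod_cast Nat.le_succ i) hi
    obtain ⟨hok, hk, hdec, hev⟩ := ih hi'
    have hstep := hrun.2 i hi
    refine ⟨hok.step hf (hU i hi') (hg i hi') hstep, ?_⟩
    rcases hok.step_cases hf (hU i hi') hstep hε with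
      ⟨hp, hp', ek, ex, el⟩ | ⟨hp, hp', ek, ex, el⟩ | ⟨hp, hp', ek, hle, el, hd⟩
    -- The pending evaluation becomes a log entry, so the sum does not change.
    · rw [reached_succ_of_eq ek ex, ek, ex]
      refine ⟨hk, hdec, le_trans (le_of_eq ?_) hev⟩
      simp [pending, hp, hp', Config.gradEvals, el, List.countP_cons]
    · rw [reached_succ_of_eq ek ex, ek, ex]
      refine ⟨hk, hdec, le_trans (le_of_eq ?_) hev⟩
      simp [pending, hp, hp', Config.gradEvals, el]
    · have hev' : (run (i + 1)).gradEvals f ε ≤ (reached f run ε i).card := by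
        simp only [Config.gradEvals, el]
        exact le_trans (Nat.le_add_right _ _) hev
      by_cases h : ε < ‖∇ f (run (i + 1)).x‖
      -- All earlier elements are at most the old counter, which has just increased.
      · have hnot : (run (i + 1)).k ∉ reached f run ε i := fun hmem => by
          have := hk _ hmem
          omega
        rw [reached_succ h, Finset.card_insert_of_notMem hnot]
        refine ⟨?_, ?_, ?_⟩
        · intro k hmem
          rcases Finset.mem_insert.1 hmem with rfl | hmem
          · exact le_rfl
          · have := hk k hmem
            omega
        · have := hd h
          push_cast
          linarith
        · rw [pending, if_pos ⟨hp', h⟩]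
          omega
      · rw [reached_succ_of_not h]
        refine ⟨fun k hmem => (hk k hmem).trans (by omega), by linarith, ?_⟩
        rw [pending, if_neg (fun hc => h hc.2)]
        exact hev'

lemma div_decrease (P : Params) (σ₀ gLip : ℝ) {HLip ε : ℝ} (hH : 0 < HLip) (hε : 0 < ε)
    (gap : ℝ) :
    gap / decrease P σ₀ gLip HLip ε = gap * stepConst P σ₀ gLip HLip ^ (3 / 2 : ℝ) /
      (P.η * (1 - P.ξ₂) ^ (3 / 2 : ℝ)) * ε ^ (-(3 / 2) : ℝ) := by
  have h1 := Real.rpow_pos_of_pos (stepConst_pos P σ₀ gLip hH) (3 / 2)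
  have h2 := Real.rpow_pos_of_pos hε (3 / 2)
  have h3 := Real.rpow_pos_of_pos (sub_pos.2 P.ξ₂_mem.2) (3 / 2)
  have h4 := P.η_mem.1
  rw [decrease, Real.rpow_neg hε.le]
  field_simp

end Counting

end ITrace

end

/-! ### The complexity bound -/

open ITrace in
theorem theorem3p1 (P : Params) (σ₀ gLip HLip gap : ℝ)
    (hσ₀ : σ₀ ∈ Set.Icc P.sigLo P.sigHi) (hgLip : 0 < gLip) (hHLip : 0 < HLip) :
    ∃ c : ℝ, 0 < c ∧
      ∀ (n : ℕ) (f : Vec n → ℝ) (finf : ℝ) (x₀ : Vec n) (δ₀ : ℝ)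
        (N : ℕ∞) (run : ℕ → Config n) (U : Set (Vec n)),
        ContDiff ℝ 2 f →
        (∀ x, finf ≤ f x) →
        f x₀ - finf ≤ gap →
        0 < δ₀ →
        IsRun P f x₀ δ₀ σ₀ N run →
        IsOpen U →
        Convex ℝ U →
        (∀ i : ℕ, (i : ℕ∞) ≤ N → (run i).points ⊆ U) →
        (∀ x ∈ U, ∀ y ∈ U, ‖∇ f x - ∇ f y‖ ≤ gLip * ‖x - y‖) →
        (∀ x ∈ U, ∀ y ∈ U, ‖hess f x - hess f y‖ ≤ HLip * ‖x - y‖) →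
        (∀ i : ℕ, (i : ℕ∞) ≤ N → ∇ f (run i).x ≠ 0) →
        ∀ ε ∈ Set.Ioo (0 : ℝ) 1,
          (nonstationary f N run ε).encard ≤ (K P σ₀ gLip HLip (f x₀ - finf) ε : ℕ∞) ∧
          ((nonstationary f N run ε).ncard : ℝ) ≤ c * ε ^ (-(3 / 2) : ℝ) ∧
          ∀ i : ℕ, (i : ℕ∞) ≤ N → ((run i).gradEvals f ε : ℝ) ≤ c * ε ^ (-(3 / 2) : ℝ) := by
  set A : ℝ := stepConst P σ₀ gLip HLip ^ (3 / 2 : ℝ) / (P.η * (1 - P.ξ₂) ^ (3 / 2 : ℝ)) with hA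
  have hA0 : 0 < A := by
    have h1 := stepConst_pos P σ₀ gLip hHLip
    have h2 := P.η_mem.1
    have h3 := sub_pos.2 P.ξ₂_mem.2
    positivity
  -- The 1 absorbs the leading 1 of `K`, since `ε ^ (-(3/2)) ≥ 1`; the absolute value makes the
  -- constant positive before `gap` is known to be nonnegative.
  refine ⟨1 + |gap| * A, by positivity, ?_⟩
  intro n f finf x₀ δ₀ N run U hf hinf hgap _ hrun _ hconv hU hgl hHl hg ε hε
  have hsm : Smooth f U gLip HLip := ⟨hf, hconv, hgLip.le, hHLip, hgl, hHl⟩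
  have hD := decrease_pos P σ₀ gLip hHLip hε.1
  have hdiv := div_decrease P σ₀ gLip hHLip hε.1 (f x₀ - finf)
  have hacc := run_accounting hsm (le_max_left _ _) hrun hU hg hε.1
  have hcard : ∀ i : ℕ, (i : ℕ∞) ≤ N →
      (reached f run ε i).card ≤ K P σ₀ gLip HLip (f x₀ - finf) ε := by
    intro i hi
    have h1 := (hacc i hi).2.2.1
    have h2 := hinf (run i).x
    rw [K, ← stepConst, ← hdiv]
    have h3 : ((reached f run ε i).card : ℝ) - 1 ≤
        (f x₀ - finf) / decrease P σ₀ gLip HLip ε := by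
      rw [le_div_iff₀ hD]; nlinarith
    have h4 : (reached f run ε i).card - 1 ≤
        ⌊(f x₀ - finf) / decrease P σ₀ gLip HLip ε⌋₊ := by
      refine Nat.le_floor ?_
      rcases Nat.eq_zero_or_pos (reached f run ε i).card with h0 | h0
      · rw [h0]
        simpa using div_nonneg (sub_nonneg.2 (hinf x₀)) hD.le
      · rw [Nat.cast_sub h0]
        simpa using h3
    omega
  have hK : (K P σ₀ gLip HLip (f x₀ - finf) ε : ℝ) ≤ (1 + |gap| * A) * ε ^ (-(3 / 2) : ℝ) := by
    have h1 : 1 ≤ ε ^ (-(3 / 2) : ℝ) :=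
      Real.one_le_rpow_of_pos_of_le_one_of_nonpos hε.1 hε.2.le (by norm_num)
    have h2 : 0 ≤ f x₀ - finf := sub_nonneg.2 (hinf x₀)
    rw [K, ← stepConst, mul_div_assoc, ← hA]
    push_cast
    have h3 := Nat.floor_le (a := (f x₀ - finf) * A * ε ^ (-(3 / 2) : ℝ)) (by positivity)
    have h4 : (f x₀ - finf) * A * ε ^ (-(3 / 2) : ℝ) ≤ |gap| * A * ε ^ (-(3 / 2) : ℝ) := by
      have := hgap.trans (le_abs_self gap)
      gcongr
    linarith
  have hencard : (nonstationary f N run ε).encard ≤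
      (K P σ₀ gLip HLip (f x₀ - finf) ε : ℕ∞) := by
    -- The run may be infinite, whereas `hcard` concerns finite prefixes. A violation would give a
    -- subset of `K + 1` elements, which is already contained in `reached` at a single run index.
    by_contra! hlt
    obtain ⟨t, ht, htc⟩ := Set.exists_subset_encard_eq (Order.add_one_le_of_lt hlt)
    have htfin : t.Finite := Set.finite_of_encard_eq_coe
      (k := K P σ₀ gLip HLip (f x₀ - finf) ε + 1) (by rw [htc]; norm_cast)
    obtain ⟨i, hi, hti⟩ : ∃ i : ℕ, (i : ℕ∞) ≤ N ∧ t ⊆ reached f run ε i := by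
      clear htc
      induction t, htfin using Set.Finite.induction_on with
      | empty => exact ⟨0, by simp, by simp⟩
      | @insert a s _ _ ih =>
        obtain ⟨i, hi, his⟩ := ih ((Set.subset_insert a s).trans ht)
        obtain ⟨m, hm, hk, hεm⟩ := ht (Set.mem_insert a s)
        refine ⟨max i m, by rcases max_choice i m with h | h <;> rw [h] <;> assumption, ?_⟩
        refine Set.insert_subset (mem_reached.2 ⟨m, le_max_right _ _, hεm, hk⟩) ?_
        exact his.trans (reached_mono (le_max_left _ _))
    have h1 := Set.encard_le_encard hti
    rw [htc, Set.encard_coe_eq_coe_finsetCard] at h1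
    have h2 : K P σ₀ gLip HLip (f x₀ - finf) ε + 1 ≤ (reached f run ε i).card := by
      exact_mod_cast h1
    have := hcard i hi
    omega
  refine ⟨hencard, ?_, fun i hi => ?_⟩
  · refine le_trans ?_ hK
    have h1 : (nonstationary f N run ε).ncard ≤ K P σ₀ gLip HLip (f x₀ - finf) ε := by
      rw [Set.ncard_def]
      exact ENat.toNat_le_of_le_natCast hencard
    exact_mod_cast h1
  · refine le_trans ?_ hK
    have h1 := (hacc i hi).2.2.2
    have h2 := hcard i hi
    have h3 : (run i).gradEvals f ε ≤ K P σ₀ gLip HLip (f x₀ - finf) ε := by omega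
    exact_mod_cast h3
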